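/- All graphs are simple. For a graph $G$, let $\operatorname{M}(G)$ (the metamour graph) be the graph on $V(G)$ in which $x,y$ are adjacent iff $d_G(x,y)=2$, and put $\operatorname{M}^0(G)=G$, $\operatorname{M}^{k+1}(G)=\operatorname{M}(\operatorname{M}^k(G))$. $G$ has *metamour limit period* $k\ge 1$ if there is $N\in\mathbb{N}$ with $\operatorname{M}^{k+i}(G)=\operatorname{M}^i(G)$ for all $i\ge N$, and $k$ is the least positive integer with this property; the *metamour limit set* of $G$ is then $\{\operatorname{M}^i(G)\mid i\ge N\}$ (equality means equality of graphs on the labelled vertex set). For distinct vertices $u,v$ and $k\ge 1$, a *2-walk of length $k$* from $u$ to $v$ is a walk $(w_0,\dots,w_{2^k})$ in $G$ with $w_0=u$, $w_{2^k}=v$ such that (1) for all $0\le i\le k-1$ and $0\le j\le 2^{k-i-1}-1$ the vertices $w_{2j\cdot 2^i}, w_{(2j+1)2^i}, w_{2(j+1)2^i}$ are distinct, and (2) $w_{2j}w_{2(j+1)}\notin E(G)$ for all $0\le j\le 2^{k-1}-1$. It is *fully minimal* if for all $1\le i\le k-1$ and $0\le j\le 2^{k-i-1}-1$ there is no 2-walk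 of length $i$ from $w_{j2^{i+1}}$ to $w_{(j+1)2^{i+1}}$. Let $\operatorname{FM}_k(G)$ be the set of unordered pairs $uv$ of distinct vertices for which there is a fully minimal 2-walk of length $k$ from $u$ to $v$, and let $\operatorname{FM}_{ev}(G)$, $\operatorname{FM}_{od}(G)$ be the unions of the $\operatorname{FM}_k(G)$ over all even, respectively odd, $k\ge1$. $\operatorname{FM}_{ev}(G)$ (resp. $\operatorname{FM}_{od}(G)$) *stabilizes by* $N$ if it is already the union of the $\operatorname{FM}_k(G)$ over even (resp. odd) $k$ with $1\le k\le N$. Let $m\ge 5$ and let $G=G(m,2)$ be the generalized Petersen graph with vertices $v_i,u_i$ ($i\in\mathbb{Z}/m$) and edges $v_iv_{i+1}$, $v_iu_i$, $u_iu_{i+2}$. **Theorem.** $G$ has metamour limit period $2$, and its metamour limit set consists of $(V(G),\operatorname{FM}_{ev}(G))$ and $(V(G),\operatorname{FM}_{od}(G))$. The set $\operatorname{FM}_{od}(G)$ stabilizes by $2\lfloor m/2\rfloor+m-8$; the set $\operatorname{FM}_{ev}(G)$ stabilizes by $2\lfloor m/2\rfloor+m-8$ if $m\neq5$, and by $2$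 if $m=5$. Moreover, $\operatorname{FM}_{ev}(G)=E(\operatorname{M}^{2\ell}(G))$ and $\operatorname{FM}_{od}(G)=E(\operatorname{M}^{2\ell+1}(G))$ for all sufficiently large $\ell\in\mathbb{N}$. Finally, $\operatorname{FM}_{ev}(G)\cup\operatorname{FM}_{od}(G)=E(G)\cup E(\overline{G})$, i.e. the set of all pairs of distinct vertices, and this union is disjoint. -/

import Mathlib

/-- The metamour graph (2-distance graph) of `G`: same vertices, and `x`, `y` are adjacent if and
only if their distance in `G` (with values in `ℕ∞`) is exactly `2`. -/
def metamour {V : Type*} (G : SimpleGraph V) : SimpleGraph V where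
  Adj x y := G.edist x y = 2
  symm := ⟨fun x y h => by rw [SimpleGraph.edist_comm]; exact h⟩
  loopless := ⟨fun x h => by simp at h⟩

/-- The iterated metamour graph `M^k(G)`. -/
def metamourIter {V : Type*} (G : SimpleGraph V) (k : ℕ) : SimpleGraph V :=
  metamour^[k] G

/-- `M^(k+i)(G) = M^i(G)` for all `i ≥ N`. -/
def IsMetamourPeriodicFrom {V : Type*} (G : SimpleGraph V) (k N : ℕ) : Prop :=
  ∀ i, N ≤ i → metamourIter G (k + i) = metamourIter G i

/-- `G` has metamour limit period `k`: `k` is the least positive integer for which the sequence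
`M^i(G)` is eventually `k`-periodic. -/
def HasMetamourLimitPeriod {V : Type*} (G : SimpleGraph V) (k : ℕ) : Prop :=
  IsLeast {k : ℕ | 0 < k ∧ ∃ N, IsMetamourPeriodicFrom G k N} k

/-- `S` is the metamour limit set of `G`: `S = {M^i(G) : i ≥ N}`, where `k` is the metamour limit
period of `G` and `k`-periodicity holds from `N` on. (Such an `S` does not depend on `N`.) -/
def IsMetamourLimitSet {V : Type*} (G : SimpleGraph V) (S : Set (SimpleGraph V)) : Prop :=
  ∃ k N, HasMetamourLimitPeriod G k ∧ IsMetamourPeriodicFrom G k N ∧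
    S = {H | ∃ i, N ≤ i ∧ H = metamourIter G i}

/-- The generalized Petersen graph `G(m, j)` (meant for `m ≥ 5` and `1 ≤ j < m / 2`). The exterior
vertices are `v_i = Sum.inl i` and the interior vertices are `u_i = Sum.inr i`, with `i` modulo `m`;
the edges are `v_i v_{i+1}`, `v_i u_i` and `u_i u_{i+j}`. -/
def generalizedPetersen (m j : ℕ) : SimpleGraph (ZMod m ⊕ ZMod m) :=
  SimpleGraph.fromRel fun x y =>
    (∃ i, x = Sum.inl i ∧ y = Sum.inl (i + 1)) ∨
    (∃ i, x = Sum.inl i ∧ y = Sum.inr i) ∨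
    (∃ i, x = Sum.inr i ∧ y = Sum.inr (i + (j : ZMod m)))

/-- The walk `p = (w_0, ..., w_{2^k})` from `u` to `v` is a 2-walk of length `k ≥ 1`. -/
structure IsTwoWalk {V : Type*} {G : SimpleGraph V} {u v : V} (k : ℕ) (p : G.Walk u v) :
    Prop where
  pos : 0 < k
  ne : u ≠ v
  length_eq : p.length = 2 ^ k
  distinct : ∀ i j : ℕ, i < k → j < 2 ^ (k - i - 1) →
    p.getVert (2 * j * 2 ^ i) ≠ p.getVert ((2 * j + 1) * 2 ^ i) ∧
    p.getVert ((2 * j + 1) * 2 ^ i) ≠ p.getVert (2 * (j + 1) * 2 ^ i) ∧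
    p.getVert (2 * j * 2 ^ i) ≠ p.getVert (2 * (j + 1) * 2 ^ i)
  not_adj : ∀ j : ℕ, j < 2 ^ (k - 1) →
    ¬ G.Adj (p.getVert (2 * j)) (p.getVert (2 * (j + 1)))

/-- A 2-walk `(w_0, ..., w_{2^k})` of length `k` is fully minimal if for `1 ≤ i ≤ k - 1` and
`0 ≤ j ≤ 2^(k-i-1) - 1` there is no 2-walk of length `i` from `w_{j 2^(i+1)}` to
`w_{(j+1) 2^(i+1)}`. -/
structure IsFullyMinimalTwoWalk {V : Type*} {G : SimpleGraph V} {u v : V} (k : ℕ)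
    (p : G.Walk u v) : Prop where
  isTwoWalk : IsTwoWalk k p
  minimal : ∀ i j : ℕ, 1 ≤ i → i < k → j < 2 ^ (k - i - 1) →
    ¬ ∃ q : G.Walk (p.getVert (j * 2 ^ (i + 1))) (p.getVert ((j + 1) * 2 ^ (i + 1))),
      IsTwoWalk i q

/-- The fully minimal `k`-set `FM_k(G)`: all unordered pairs `uv` of distinct vertices joined by a
fully minimal 2-walk of length `k` (empty for `k = 0`). -/
def FMset {V : Type*} (G : SimpleGraph V) (k : ℕ) : Set (Sym2 V) :=
  {e | ∃ u v : V, u ≠ v ∧ e = s(u, v) ∧ ∃ p : G.Walk u v, IsFullyMinimalTwoWalk k p}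

/-- `FM_ev(G)`, the union of the `FM_k(G)` over all even `k ≥ 1`. -/
def FMev {V : Type*} (G : SimpleGraph V) : Set (Sym2 V) :=
  {e | ∃ k : ℕ, 1 ≤ k ∧ Even k ∧ e ∈ FMset G k}

/-- `FM_od(G)`, the union of the `FM_k(G)` over all odd `k ≥ 1`. -/
def FMod {V : Type*} (G : SimpleGraph V) : Set (Sym2 V) :=
  {e | ∃ k : ℕ, 1 ≤ k ∧ Odd k ∧ e ∈ FMset G k}

/-- `FM_ev(G)` stabilizes by `N`: it is the union of the `FM_k(G)` over even `k` with
`1 ≤ k ≤ N`. -/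
def FMevStabilizesBy {V : Type*} (G : SimpleGraph V) (N : ℕ) : Prop :=
  FMev G = {e | ∃ k : ℕ, 1 ≤ k ∧ k ≤ N ∧ Even k ∧ e ∈ FMset G k}

/-- `FM_od(G)` stabilizes by `N`: it is the union of the `FM_k(G)` over odd `k` with
`1 ≤ k ≤ N`. -/
def FModStabilizesBy {V : Type*} (G : SimpleGraph V) (N : ℕ) : Prop :=
  FMod G = {e | ∃ k : ℕ, 1 ≤ k ∧ k ≤ N ∧ Odd k ∧ e ∈ FMset G k}

/-! ### 2-walks and fully minimal 2-walks as relations defined by recursion on the length. -/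

section General

variable {V : Type*} {G : SimpleGraph V}

/-! A 2-walk of length `n + 1` splits at its middle into two of length `n`, so only the relations
`twoStep` and `fullMin` matter. Suppose that the relations `twoStep G n` increase with `n` (`hT`),
that a pair entering at level `n + 1` has a midpoint whose two halves entered at level `n`, so that
it is fully minimal (`hD`), that edges of `G` enter at level 1 (`hE`), and that some level `K`
contains all pairs of distinct vertices (`hfull`). Then each pair has exactly one birth level, and
by `metamourIter_succ_adj_iff` the edges of `M^(n+1)(G)` are the pairs born at a level `j ≤ n` with
`j ≡ n` mod 2. Past level `K` only the parity of `n` counts, which gives period 2, the limit set and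
the partition.

For `G(m, 2)` everything is governed by the cyclic distance of indices. From level 1 on, `twoStep`
is the relation `reach R` on distinct vertices, with `R` passing to `2 * R + 4` at each level:
`reach_comp` gives one inclusion, and `exists_midpoint` gives both the other and `hD`. Since `R`
eventually exceeds `m / 2`, all pairs are born early, which yields the stabilization bounds. -/

theorem metamour_adj_iff {x y : V} :
    (metamour G).Adj x y ↔ x ≠ y ∧ ¬ G.Adj x y ∧ ∃ z, G.Adj x z ∧ G.Adj z y := by
  refine SimpleGraph.edist_eq_two_iff.trans ?_
  simp only [Set.Nonempty, SimpleGraph.mem_commonNeighbors, G.adj_comm y]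

/-- `twoStep G n x y` says that `x ≠ y` are joined by a 2-walk of length `n + 1`. -/
def twoStep (G : SimpleGraph V) : ℕ → V → V → Prop
  | 0, x, y => (metamour G).Adj x y
  | n + 1, x, y => x ≠ y ∧ ∃ z, twoStep G n x z ∧ twoStep G n z y

/-- `fullMin G n x y` says that `x ≠ y` are joined by a fully minimal 2-walk of length `n + 1`. -/
def fullMin (G : SimpleGraph V) : ℕ → V → V → Prop
  | 0, x, y => (metamour G).Adj x y
  | n + 1, x, y => x ≠ y ∧ (∃ z, fullMin G n x z ∧ fullMin G n z y) ∧ ¬ twoStep G n x y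

theorem twoStep.ne {n : ℕ} {x y : V} (h : twoStep G n x y) : x ≠ y := by
  cases n with
  | zero => exact SimpleGraph.Adj.ne h
  | succ n => exact h.1

theorem twoStep.symm {n : ℕ} {x y : V} (h : twoStep G n x y) : twoStep G n y x := by
  induction n generalizing x y with
  | zero => exact SimpleGraph.Adj.symm h
  | succ n ih =>
    obtain ⟨hne, z, h1, h2⟩ := h
    exact ⟨hne.symm, z, ih h2, ih h1⟩

theorem fullMin.twoStep {n : ℕ} {x y : V} (h : fullMin G n x y) : twoStep G n x y := by
  induction n generalizing x y with
  | zero => exact h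
  | succ n ih =>
    obtain ⟨hne, ⟨z, h1, h2⟩, -⟩ := h
    exact ⟨hne, z, ih h1, ih h2⟩

theorem fullMin.symm {n : ℕ} {x y : V} (h : fullMin G n x y) : fullMin G n y x := by
  induction n generalizing x y with
  | zero => exact SimpleGraph.Adj.symm h
  | succ n ih =>
    obtain ⟨hne, ⟨z, h1, h2⟩, h3⟩ := h
    exact ⟨hne.symm, ⟨z, ih h2, ih h1⟩, fun h => h3 h.symm⟩

/-- A family of relations in which each level decomposes through the previous one, down to the
metamour graph, is realized along a walk. -/
theorem exists_walk_of_decomposition {P : ℕ → V → V → Prop}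
    (h0 : ∀ x y, P 0 x y → (metamour G).Adj x y)
    (hs : ∀ n x y, P (n + 1) x y → ∃ z, P n x z ∧ P n z y) (n : ℕ) (x y : V) (h : P n x y) :
    ∃ p : G.Walk x y, p.length = 2 ^ (n + 1) ∧ ∀ i j, i ≤ n → j < 2 ^ (n - i) →
      P i (p.getVert (j * 2 ^ (i + 1))) (p.getVert ((j + 1) * 2 ^ (i + 1))) := by
  induction n generalizing x y with
  | zero =>
    obtain ⟨-, -, z, hxz, hzy⟩ := metamour_adj_iff.mp (h0 x y h)
    refine ⟨.cons hxz (.cons hzy .nil), by simp, fun i j hi hj => ?_⟩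
    obtain rfl : i = 0 := by omega
    obtain rfl : j = 0 := by simpa using hj
    simpa using h
  | succ n ih =>
    obtain ⟨z, h1, h2⟩ := hs n x y h
    obtain ⟨p, hp, hpP⟩ := ih x z h1
    obtain ⟨q, hq, hqP⟩ := ih z y h2
    have hlen : (p.append q).length = 2 ^ (n + 2) := by
      rw [SimpleGraph.Walk.length_append, hp, hq]; ring
    have hleft : ∀ t, t ≤ 2 ^ (n + 1) → (p.append q).getVert t = p.getVert t := by
      intro t ht
      rw [SimpleGraph.Walk.getVert_append]
      split_ifs with hlt
      · rfl
      · obtain rfl : t = p.length := by omega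
        simp
    have hright : ∀ t, (p.append q).getVert (2 ^ (n + 1) + t) = q.getVert t := by
      intro t
      rw [SimpleGraph.Walk.getVert_append, if_neg (by omega), hp]
      congr 1; omega
    refine ⟨p.append q, hlen, fun i j hi hj => ?_⟩
    rcases Nat.lt_or_ge n i with hin | hin
    · obtain rfl : i = n + 1 := by omega
      obtain rfl : j = 0 := by simpa using hj
      have e : (p.append q).getVert ((0 + 1) * 2 ^ (n + 1 + 1)) = y := by
        rw [show (0 + 1) * 2 ^ (n + 1 + 1) = (p.append q).length by rw [hlen]; ring,
          SimpleGraph.Walk.getVert_length]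
      rw [e]
      simpa using h
    · have hpow : 2 ^ (n + 1) = 2 ^ (n - i) * 2 ^ (i + 1) := by
        rw [← pow_add]; congr 1; omega
      have hsplit : 2 ^ (n + 1 - i) = 2 ^ (n - i) + 2 ^ (n - i) := by
        rw [show n + 1 - i = n - i + 1 by omega]; ring
      rcases Nat.lt_or_ge j (2 ^ (n - i)) with hj' | hj'
      · rw [hleft, hleft]
        · exact hpP i j hin hj'
        · rw [hpow]; exact Nat.mul_le_mul_right _ hj'
        · rw [hpow]; exact Nat.mul_le_mul_right _ hj'.le
      · obtain ⟨t, rfl⟩ := Nat.exists_eq_add_of_le hj'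
        have e1 : (2 ^ (n - i) + t) * 2 ^ (i + 1) = 2 ^ (n + 1) + t * 2 ^ (i + 1) := by
          rw [hpow]; ring
        have e2 : (2 ^ (n - i) + t + 1) * 2 ^ (i + 1) = 2 ^ (n + 1) + (t + 1) * 2 ^ (i + 1) := by
          rw [hpow]; ring
        rw [e1, e2, hright, hright]
        exact hqP i t hin (by omega)

/-- At scale `2 ^ i` the outer vertices differ by level `i`; each consecutive pair differs by level
`i - 1`, or, when `i = 0`, because it is an edge of the walk. -/
theorem isTwoWalk_of_twoStep {n : ℕ} {x y : V} {p : G.Walk x y} (hne : x ≠ y)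
    (hlen : p.length = 2 ^ (n + 1)) (h : ∀ i j, i ≤ n → j < 2 ^ (n - i) →
      twoStep G i (p.getVert (j * 2 ^ (i + 1))) (p.getVert ((j + 1) * 2 ^ (i + 1)))) :
    IsTwoWalk (n + 1) p where
  pos := n.succ_pos
  ne := hne
  length_eq := hlen
  distinct := by
    intro i j hi hj
    have hj' : j < 2 ^ (n - i) := by rwa [show n + 1 - i - 1 = n - i by omega] at hj
    have h3 := (h i j (by omega) hj').ne
    rw [show j * 2 ^ (i + 1) = 2 * j * 2 ^ i by ring,
      show (j + 1) * 2 ^ (i + 1) = 2 * (j + 1) * 2 ^ i by ring] at h3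
    refine ⟨?_, ?_, h3⟩
    · cases i with
      | zero =>
        have : 2 ^ (n + 1) = 2 * 2 ^ n := by ring
        simpa using (p.adj_getVert_succ (i := 2 * j) (by rw [hlen]; simp at hj'; omega)).ne
      | succ i =>
        have hp : 2 ^ (n - i) = 2 * 2 ^ (n - (i + 1)) := by
          rw [show n - i = n - (i + 1) + 1 by omega]; ring
        exact (h i (2 * j) (by omega) (by omega)).ne
    · cases i with
      | zero =>
        have : 2 ^ (n + 1) = 2 * 2 ^ n := by ring
        have := (p.adj_getVert_succ (i := 2 * j + 1) (by rw [hlen]; simp at hj'; omega)).ne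
        simpa [mul_add] using this
      | succ i =>
        have hp : 2 ^ (n - i) = 2 * 2 ^ (n - (i + 1)) := by
          rw [show n - i = n - (i + 1) + 1 by omega]; ring
        have := (h i (2 * j + 1) (by omega) (by omega)).ne
        rwa [show 2 * j + 1 + 1 = 2 * (j + 1) by ring] at this
  not_adj := by
    intro j hj
    have := h 0 j (by omega) (by simpa using hj)
    have := (metamour_adj_iff.mp this).2.1
    simpa [mul_comm] using this

theorem IsTwoWalk.metamour_adj {n : ℕ} {x y : V} {p : G.Walk x y} (h : IsTwoWalk (n + 1) p)
    {j : ℕ} (hj : j < 2 ^ n) : (metamour G).Adj (p.getVert (j * 2)) (p.getVert ((j + 1) * 2)) := by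
  have hd := h.distinct 0 j (by omega) (by simpa using hj)
  have hl := h.length_eq
  have : 2 ^ (n + 1) = 2 * 2 ^ n := by ring
  refine metamour_adj_iff.mpr ⟨by simpa [mul_comm] using hd.2.2,
    by simpa [mul_comm] using h.not_adj j (by simpa using hj), p.getVert (j * 2 + 1), ?_, ?_⟩
  · exact p.adj_getVert_succ (by omega)
  · have := p.adj_getVert_succ (i := j * 2 + 1) (by omega)
    rwa [show j * 2 + 1 + 1 = (j + 1) * 2 by ring] at this

theorem IsTwoWalk.level_ne {n : ℕ} {x y : V} {p : G.Walk x y} (h : IsTwoWalk (n + 1) p)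
    {i j : ℕ} (hi : i ≤ n) (hj : j < 2 ^ (n - i)) :
    p.getVert (j * 2 ^ (i + 1)) ≠ p.getVert ((j + 1) * 2 ^ (i + 1)) := by
  have := (h.distinct i j (by omega) (by rwa [show n + 1 - i - 1 = n - i by omega])).2.2
  rwa [show j * 2 ^ (i + 1) = 2 * j * 2 ^ i by ring,
    show (j + 1) * 2 ^ (i + 1) = 2 * (j + 1) * 2 ^ i by ring]

theorem IsTwoWalk.twoStep_level {n : ℕ} {x y : V} {p : G.Walk x y} (h : IsTwoWalk (n + 1) p)
    {i j : ℕ} (hi : i ≤ n) (hj : j < 2 ^ (n - i)) :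
    twoStep G i (p.getVert (j * 2 ^ (i + 1))) (p.getVert ((j + 1) * 2 ^ (i + 1))) := by
  induction i generalizing j with
  | zero => simpa [twoStep] using h.metamour_adj (by simpa using hj)
  | succ i ih =>
    have hp : 2 ^ (n - i) = 2 * 2 ^ (n - (i + 1)) := by
      rw [show n - i = n - (i + 1) + 1 by omega]; ring
    refine ⟨h.level_ne hi hj, p.getVert ((2 * j + 1) * 2 ^ (i + 1)), ?_, ?_⟩
    · have := ih (j := 2 * j) (by omega) (by omega)
      rwa [show 2 * j * 2 ^ (i + 1) = j * 2 ^ (i + 1 + 1) by ring] at this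
    · have := ih (j := 2 * j + 1) (by omega) (by omega)
      rwa [show (2 * j + 1 + 1) * 2 ^ (i + 1) = (j + 1) * 2 ^ (i + 1 + 1) by ring] at this

theorem exists_isTwoWalk_iff {n : ℕ} {x y : V} :
    (∃ p : G.Walk x y, IsTwoWalk (n + 1) p) ↔ twoStep G n x y := by
  constructor
  · rintro ⟨p, hp⟩
    have := hp.twoStep_level le_rfl (j := 0) (by simp)
    have hl : p.getVert ((0 + 1) * 2 ^ (n + 1)) = y := by
      rw [show (0 + 1) * 2 ^ (n + 1) = p.length by rw [hp.length_eq]; ring]; simp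
    rw [hl] at this
    simpa using this
  · intro h
    obtain ⟨p, hp, hP⟩ := exists_walk_of_decomposition (P := twoStep G) (fun _ _ h => h)
      (fun _ _ _ h => h.2) n x y h
    exact ⟨p, isTwoWalk_of_twoStep h.ne hp hP⟩

/-- Full minimality is a condition on each dyadic block separately: a block of length `2 ^ (i + 1)`
must not be bridged by a 2-walk of length `i`. This is the negated clause of `fullMin` at index `i`.
-/
theorem exists_isFullyMinimalTwoWalk_iff {n : ℕ} {x y : V} :
    (∃ p : G.Walk x y, IsFullyMinimalTwoWalk (n + 1) p) ↔ fullMin G n x y := by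
  constructor
  · rintro ⟨p, hp⟩
    have key : ∀ i j, i ≤ n → j < 2 ^ (n - i) →
        fullMin G i (p.getVert (j * 2 ^ (i + 1))) (p.getVert ((j + 1) * 2 ^ (i + 1))) := by
      intro i
      induction i with
      | zero =>
        intro j _ hj
        simpa [fullMin] using hp.isTwoWalk.metamour_adj (by simpa using hj)
      | succ i ih =>
        intro j hi hj
        have hpw : 2 ^ (n - i) = 2 * 2 ^ (n - (i + 1)) := by
          rw [show n - i = n - (i + 1) + 1 by omega]; ring
        refine ⟨hp.isTwoWalk.level_ne hi hj, ⟨p.getVert ((2 * j + 1) * 2 ^ (i + 1)), ?_, ?_⟩, ?_⟩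
        · have := ih (2 * j) (by omega) (by omega)
          rwa [show 2 * j * 2 ^ (i + 1) = j * 2 ^ (i + 1 + 1) by ring] at this
        · have := ih (2 * j + 1) (by omega) (by omega)
          rwa [show (2 * j + 1 + 1) * 2 ^ (i + 1) = (j + 1) * 2 ^ (i + 1 + 1) by ring] at this
        · rw [← exists_isTwoWalk_iff]
          refine hp.minimal (i + 1) j (by omega) (by omega) ?_
          rwa [show n + 1 - (i + 1) - 1 = n - (i + 1) by omega]
    have := key n 0 le_rfl (by simp)
    have hl : p.getVert ((0 + 1) * 2 ^ (n + 1)) = y := by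
      rw [show (0 + 1) * 2 ^ (n + 1) = p.length by rw [hp.isTwoWalk.length_eq]; ring]; simp
    rw [hl] at this
    simpa using this
  · intro h
    obtain ⟨p, hp, hP⟩ := exists_walk_of_decomposition (P := fullMin G) (fun _ _ h => h)
      (fun _ _ _ h => h.2.1) n x y h
    refine ⟨p, isTwoWalk_of_twoStep h.twoStep.ne hp fun i j hi hj => (hP i j hi hj).twoStep, ?_⟩
    intro i j hi hin hj
    obtain ⟨i, rfl⟩ := Nat.exists_eq_add_of_le' hi
    rw [exists_isTwoWalk_iff]
    exact (hP (i + 1) j (by omega) (by rwa [show n + 1 - (i + 1) - 1 = n - (i + 1) by omega] at hj)).2.2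

theorem mk_mem_FMset_succ {n : ℕ} {x y : V} : s(x, y) ∈ FMset G (n + 1) ↔ fullMin G n x y := by
  constructor
  · rintro ⟨u, v, -, he, hp⟩
    rw [exists_isFullyMinimalTwoWalk_iff] at hp
    rcases Sym2.eq_iff.mp he with ⟨rfl, rfl⟩ | ⟨rfl, rfl⟩
    · exact hp
    · exact hp.symm
  · intro h
    exact ⟨x, y, h.twoStep.ne, rfl, exists_isFullyMinimalTwoWalk_iff.mpr h⟩

/-- Index `n` stands for length `n + 1`, so even lengths are odd indices. -/
theorem mk_mem_FMev {x y : V} : s(x, y) ∈ FMev G ↔ ∃ n, n % 2 = 1 ∧ fullMin G n x y := by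
  constructor
  · rintro ⟨k, hk, he, h⟩
    obtain ⟨n, rfl⟩ := Nat.exists_eq_add_of_le' hk
    exact ⟨n, by rw [Nat.even_iff] at he; omega, mk_mem_FMset_succ.mp h⟩
  · rintro ⟨n, hn, h⟩
    exact ⟨n + 1, by omega, by rw [Nat.even_iff]; omega, mk_mem_FMset_succ.mpr h⟩

theorem mk_mem_FMod {x y : V} : s(x, y) ∈ FMod G ↔ ∃ n, n % 2 = 0 ∧ fullMin G n x y := by
  constructor
  · rintro ⟨k, hk, he, h⟩
    obtain ⟨n, rfl⟩ := Nat.exists_eq_add_of_le' hk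
    exact ⟨n, by rw [Nat.odd_iff] at he; omega, mk_mem_FMset_succ.mp h⟩
  · rintro ⟨n, hn, h⟩
    exact ⟨n + 1, by omega, by rw [Nat.odd_iff]; omega, mk_mem_FMset_succ.mpr h⟩

/-! ### Birth levels of pairs, and the iterated metamour graphs they determine. -/

theorem twoStep_mono (hT : ∀ x y, twoStep G 0 x y → twoStep G 1 x y) {a b : ℕ} (hab : a ≤ b)
    {x y : V} (h : twoStep G a x y) : twoStep G b x y := by
  have step : ∀ n x y, twoStep G n x y → twoStep G (n + 1) x y := by
    intro n
    induction n with
    | zero => exact hT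
    | succ n ih =>
      rintro x y ⟨hne, z, h1, h2⟩
      exact ⟨hne, z, ih _ _ h1, ih _ _ h2⟩
  induction hab with
  | refl => exact h
  | step _ ih => exact step _ _ _ ih

/-- Being fully minimal at level `b` excludes level `b - 1`, hence by monotonicity every smaller
level. -/
theorem fullMin_index_unique (hT : ∀ x y, twoStep G 0 x y → twoStep G 1 x y) {a b : ℕ} {x y : V}
    (ha : fullMin G a x y) (hb : fullMin G b x y) : a = b := by
  have aux : ∀ a b : ℕ, a < b → fullMin G a x y → ¬ fullMin G b x y := by
    intro a b hab ha hb
    obtain ⟨b, rfl⟩ := Nat.exists_eq_add_of_le' (show 1 ≤ b by omega)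
    exact hb.2.2 (twoStep_mono hT (by omega) ha.twoStep)
  rcases lt_trichotomy a b with h | h | h
  · exact absurd hb (aux a b h ha)
  · exact h
  · exact absurd ha (aux b a h hb)

theorem exists_fullMin_of_twoStep
    (hD : ∀ n x y, twoStep G (n + 1) x y → ¬ twoStep G n x y → fullMin G (n + 1) x y)
    {n : ℕ} {x y : V} (h : twoStep G n x y) : ∃ l ≤ n, fullMin G l x y := by
  induction n with
  | zero => exact ⟨0, le_rfl, h⟩
  | succ n ih =>
    by_cases hn : twoStep G n x y
    · obtain ⟨l, hl, hf⟩ := ih hn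
      exact ⟨l, by omega, hf⟩
    · exact ⟨n + 1, le_rfl, hD n x y h hn⟩

/-- The heart of the abstract argument. A common neighbour in `M^(n+1)(G)` puts the pair into level
`n + 1`, so it has a birth level; non-adjacency fixes the parity of that level. Conversely, a pair
of the right parity is not yet adjacent by uniqueness, and its midpoint comes from the previous
level. -/
theorem metamourIter_succ_adj_iff
    (hE : ∀ x y, G.Adj x y → ∃ z, (metamour G).Adj x z ∧ (metamour G).Adj z y)
    (hT : ∀ x y, twoStep G 0 x y → twoStep G 1 x y)
    (hD : ∀ n x y, twoStep G (n + 1) x y → ¬ twoStep G n x y → fullMin G (n + 1) x y)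
    (n : ℕ) (x y : V) :
    (metamourIter G (n + 1)).Adj x y ↔ ∃ j ≤ n, j % 2 = n % 2 ∧ fullMin G j x y := by
  have hE1 : ∀ x y, G.Adj x y → fullMin G 1 x y := fun x y h =>
    ⟨h.ne, hE x y h, fun h0 => (metamour_adj_iff.mp h0).2.1 h⟩
  induction n generalizing x y with
  | zero =>
    constructor
    · intro h
      exact ⟨0, le_rfl, rfl, h⟩
    · rintro ⟨j, hj, -, h⟩
      obtain rfl : j = 0 := by omega
      exact h
  | succ n ih =>
    rw [metamourIter, Function.iterate_succ_apply']
    change (metamour (metamourIter G (n + 1))).Adj x y ↔ _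
    simp only [metamour_adj_iff, ih]
    constructor
    · rintro ⟨hne, hna, z, ⟨i, hi, -, hxz⟩, j, hj, -, hzy⟩
      have hW : twoStep G (n + 1) x y :=
        ⟨hne, z, twoStep_mono hT hi hxz.twoStep, twoStep_mono hT hj hzy.twoStep⟩
      obtain ⟨l, hl, hf⟩ := exists_fullMin_of_twoStep hD hW
      refine ⟨l, hl, ?_, hf⟩
      -- With the wrong parity `l` differs from `n + 1`, so `l ≤ n` and the pair would already be
      -- adjacent.
      by_contra hpar
      exact hna ⟨l, by omega, by omega, hf⟩
    · rintro ⟨j, hj, hpar, hf⟩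
      refine ⟨hf.twoStep.ne, ?_, ?_⟩
      · rintro ⟨i, hi, hpi, hfi⟩
        have := fullMin_index_unique hT hf hfi
        omega
      · cases j with
        | zero =>
          -- There is no earlier level, so the midpoint comes from `G`: edges of `G` are born at
          -- level 1, and here `n` is odd, hence at least 1.
          obtain ⟨-, -, z, hxz, hzy⟩ := metamour_adj_iff.mp hf
          exact ⟨z, ⟨1, by omega, by omega, hE1 _ _ hxz⟩, 1, by omega, by omega, hE1 _ _ hzy⟩
        | succ j =>
          obtain ⟨-, ⟨z, hxz, hzy⟩, -⟩ := hf
          exact ⟨z, ⟨j, by omega, by omega, hxz⟩, j, by omega, by omega, hzy⟩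

theorem fullMin_index_le {K : ℕ} (hT : ∀ x y, twoStep G 0 x y → twoStep G 1 x y)
    (hfull : ∀ x y, x ≠ y → twoStep G K x y) {n : ℕ} {x y : V} (h : fullMin G n x y) : n ≤ K := by
  by_contra! hlt
  obtain ⟨n, rfl⟩ := Nat.exists_eq_add_of_le' (show 1 ≤ n by omega)
  exact h.2.2 (twoStep_mono hT (by omega) (hfull x y h.twoStep.ne))

theorem FMev_eq_edgeSet {K l : ℕ}
    (hE : ∀ x y, G.Adj x y → ∃ z, (metamour G).Adj x z ∧ (metamour G).Adj z y)
    (hT : ∀ x y, twoStep G 0 x y → twoStep G 1 x y)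
    (hD : ∀ n x y, twoStep G (n + 1) x y → ¬ twoStep G n x y → fullMin G (n + 1) x y)
    (hfull : ∀ x y, x ≠ y → twoStep G K x y) (hl : K + 1 ≤ l) :
    FMev G = (metamourIter G (2 * l)).edgeSet := by
  ext ⟨x, y⟩
  obtain ⟨t, ht⟩ : ∃ t, 2 * l = t + 1 := ⟨2 * l - 1, by omega⟩
  change s(x, y) ∈ _ ↔ s(x, y) ∈ _
  rw [mk_mem_FMev, SimpleGraph.mem_edgeSet, ht, metamourIter_succ_adj_iff hE hT hD]
  constructor
  · rintro ⟨n, hn, h⟩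
    have := fullMin_index_le hT hfull h
    exact ⟨n, by omega, by omega, h⟩
  · rintro ⟨n, hn, hp, h⟩
    exact ⟨n, by omega, h⟩

theorem FMod_eq_edgeSet {K l : ℕ}
    (hE : ∀ x y, G.Adj x y → ∃ z, (metamour G).Adj x z ∧ (metamour G).Adj z y)
    (hT : ∀ x y, twoStep G 0 x y → twoStep G 1 x y)
    (hD : ∀ n x y, twoStep G (n + 1) x y → ¬ twoStep G n x y → fullMin G (n + 1) x y)
    (hfull : ∀ x y, x ≠ y → twoStep G K x y) (hl : K + 1 ≤ l) :
    FMod G = (metamourIter G (2 * l + 1)).edgeSet := by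
  ext ⟨x, y⟩
  change s(x, y) ∈ _ ↔ s(x, y) ∈ _
  rw [mk_mem_FMod, SimpleGraph.mem_edgeSet, metamourIter_succ_adj_iff hE hT hD]
  constructor
  · rintro ⟨n, hn, h⟩
    have := fullMin_index_le hT hfull h
    exact ⟨n, by omega, by omega, h⟩
  · rintro ⟨n, hn, hp, h⟩
    exact ⟨n, by omega, h⟩

theorem FMev_union_FMod {K : ℕ}
    (hD : ∀ n x y, twoStep G (n + 1) x y → ¬ twoStep G n x y → fullMin G (n + 1) x y)
    (hfull : ∀ x y, x ≠ y → twoStep G K x y) :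
    FMev G ∪ FMod G = G.edgeSet ∪ Gᶜ.edgeSet := by
  ext ⟨x, y⟩
  change s(x, y) ∈ _ ↔ s(x, y) ∈ _
  rw [Set.mem_union, Set.mem_union, mk_mem_FMev, mk_mem_FMod, SimpleGraph.mem_edgeSet,
    SimpleGraph.mem_edgeSet, SimpleGraph.compl_adj]
  constructor
  · intro h
    have hne : x ≠ y := by
      rcases h with ⟨_, _, h⟩ | ⟨_, _, h⟩ <;> exact h.twoStep.ne
    tauto
  · intro h
    have hne : x ≠ y := h.elim (fun h => h.ne) (fun h => h.1)
    obtain ⟨l, -, hf⟩ := exists_fullMin_of_twoStep hD (hfull x y hne)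
    rcases Nat.mod_two_eq_zero_or_one l with hl | hl
    · exact Or.inr ⟨l, hl, hf⟩
    · exact Or.inl ⟨l, hl, hf⟩

theorem disjoint_FMev_FMod (hT : ∀ x y, twoStep G 0 x y → twoStep G 1 x y) :
    Disjoint (FMev G) (FMod G) := by
  rw [Set.disjoint_left]
  rintro ⟨x, y⟩ h1 h2
  obtain ⟨a, ha, h1⟩ := mk_mem_FMev.mp h1
  obtain ⟨b, hb, h2⟩ := mk_mem_FMod.mp h2
  have := fullMin_index_unique hT h1 h2
  omega

theorem FMevStabilizesBy_of_fullMin {N : ℕ}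
    (h : ∀ n x y, n % 2 = 1 → fullMin G n x y → n + 1 ≤ N) : FMevStabilizesBy G N := by
  ext e
  constructor
  · rintro ⟨k, hk, he, hmem⟩
    refine ⟨k, hk, ?_, he, hmem⟩
    obtain ⟨n, rfl⟩ := Nat.exists_eq_add_of_le' hk
    induction e with
    | h x y => exact h n x y (by rw [Nat.even_iff] at he; omega) (mk_mem_FMset_succ.mp hmem)
  · rintro ⟨k, hk, -, he, hmem⟩
    exact ⟨k, hk, he, hmem⟩

theorem FModStabilizesBy_of_fullMin {N : ℕ}
    (h : ∀ n x y, n % 2 = 0 → fullMin G n x y → n + 1 ≤ N) : FModStabilizesBy G N := by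
  ext e
  constructor
  · rintro ⟨k, hk, he, hmem⟩
    refine ⟨k, hk, ?_, he, hmem⟩
    obtain ⟨n, rfl⟩ := Nat.exists_eq_add_of_le' hk
    induction e with
    | h x y => exact h n x y (by rw [Nat.odd_iff] at he; omega) (mk_mem_FMset_succ.mp hmem)
  · rintro ⟨k, hk, -, he, hmem⟩
    exact ⟨k, hk, he, hmem⟩

theorem isMetamourPeriodicFrom_two {K : ℕ}
    (hE : ∀ x y, G.Adj x y → ∃ z, (metamour G).Adj x z ∧ (metamour G).Adj z y)
    (hT : ∀ x y, twoStep G 0 x y → twoStep G 1 x y)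
    (hD : ∀ n x y, twoStep G (n + 1) x y → ¬ twoStep G n x y → fullMin G (n + 1) x y)
    (hfull : ∀ x y, x ≠ y → twoStep G K x y) : IsMetamourPeriodicFrom G 2 (2 * (K + 1)) := by
  intro i hi
  rw [← SimpleGraph.edgeSet_inj]
  obtain ⟨l, rfl | rfl⟩ := Nat.even_or_odd' i
  · rw [← FMev_eq_edgeSet hE hT hD hfull (by omega), show 2 + 2 * l = 2 * (l + 1) by ring,
      ← FMev_eq_edgeSet hE hT hD hfull (by omega)]
  · rw [← FMod_eq_edgeSet hE hT hD hfull (by omega), show 2 + (2 * l + 1) = 2 * (l + 1) + 1 by ring,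
      ← FMod_eq_edgeSet hE hT hD hfull (by omega)]

theorem hasMetamourLimitPeriod_two {K : ℕ}
    (hE : ∀ x y, G.Adj x y → ∃ z, (metamour G).Adj x z ∧ (metamour G).Adj z y)
    (hT : ∀ x y, twoStep G 0 x y → twoStep G 1 x y)
    (hD : ∀ n x y, twoStep G (n + 1) x y → ¬ twoStep G n x y → fullMin G (n + 1) x y)
    (hfull : ∀ x y, x ≠ y → twoStep G K x y) (hne : ∃ x y, (metamour G).Adj x y) :
    HasMetamourLimitPeriod G 2 := by
  refine ⟨⟨by norm_num, _, isMetamourPeriodicFrom_two hE hT hD hfull⟩, ?_⟩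
  rintro k ⟨hk, N, hN⟩
  by_contra! hlt
  obtain rfl : k = 1 := by omega
  obtain ⟨x, y, hxy⟩ := hne
  have h1 : ∀ i, N ≤ i → metamourIter G (i + 1) = metamourIter G i := fun i hi => by
    rw [add_comm]; exact hN i hi
  -- Period 1 fails because a pair born at level 0 is an edge of odd iterates only, among the
  -- positive ones.
  have ha : (metamourIter G (2 * N + 1)).Adj x y :=
    (metamourIter_succ_adj_iff hE hT hD _ x y).mpr ⟨0, by omega, by omega, hxy⟩
  have hb : (metamourIter G (2 * N + 1 + 1)).Adj x y := by
    rwa [h1 (2 * N + 1) (by omega)]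
  obtain ⟨j, -, hj, hf⟩ := (metamourIter_succ_adj_iff hE hT hD _ x y).mp hb
  have := fullMin_index_unique hT hf (show fullMin G 0 x y from hxy)
  omega

theorem isMetamourLimitSet_FM {K : ℕ}
    (hE : ∀ x y, G.Adj x y → ∃ z, (metamour G).Adj x z ∧ (metamour G).Adj z y)
    (hT : ∀ x y, twoStep G 0 x y → twoStep G 1 x y)
    (hD : ∀ n x y, twoStep G (n + 1) x y → ¬ twoStep G n x y → fullMin G (n + 1) x y)
    (hfull : ∀ x y, x ≠ y → twoStep G K x y) (hne : ∃ x y, (metamour G).Adj x y) :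
    IsMetamourLimitSet G
      {SimpleGraph.fromEdgeSet (FMev G), SimpleGraph.fromEdgeSet (FMod G)} := by
  have hev : ∀ l, K + 1 ≤ l → SimpleGraph.fromEdgeSet (FMev G) = metamourIter G (2 * l) :=
    fun l hl => by rw [FMev_eq_edgeSet hE hT hD hfull hl, SimpleGraph.fromEdgeSet_edgeSet]
  have hod : ∀ l, K + 1 ≤ l → SimpleGraph.fromEdgeSet (FMod G) = metamourIter G (2 * l + 1) :=
    fun l hl => by rw [FMod_eq_edgeSet hE hT hD hfull hl, SimpleGraph.fromEdgeSet_edgeSet]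
  refine ⟨2, 2 * (K + 1), hasMetamourLimitPeriod_two hE hT hD hfull hne,
    isMetamourPeriodicFrom_two hE hT hD hfull, Set.ext fun H => ⟨?_, ?_⟩⟩
  · rintro (rfl | rfl)
    · exact ⟨2 * (K + 1), le_rfl, hev _ le_rfl⟩
    · exact ⟨2 * (K + 1) + 1, by omega, hod _ le_rfl⟩
  · rintro ⟨i, hi, rfl⟩
    obtain ⟨l, rfl | rfl⟩ := Nat.even_or_odd' i
    · exact Or.inl (hev l (by omega)).symm
    · exact Or.inr (hod l (by omega)).symm

end General

/-! ### Distance in the cycle `ℤ/m`. -/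

section CyclicNorm

variable {m : ℕ}

/-- The distance of `a` from `0` in the cycle `ℤ/m`. -/
def cycNorm (a : ZMod m) : ℕ := a.valMinAbs.natAbs

/-- `a` is one of the residues `T` and `-T`. -/
def IsPlusMinus (T : ℕ) (a : ZMod m) : Prop := a = T ∨ a = -T

theorem cycNorm_neg (a : ZMod m) : cycNorm (-a) = cycNorm a := ZMod.natAbs_valMinAbs_neg a

theorem cycNorm_sub_comm (a b : ZMod m) : cycNorm (a - b) = cycNorm (b - a) := by
  rw [← cycNorm_neg, neg_sub]

theorem IsPlusMinus.neg {T : ℕ} {a : ZMod m} (h : IsPlusMinus T a) : IsPlusMinus T (-a) := by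
  rcases h with rfl | rfl
  · exact Or.inr rfl
  · exact Or.inl (neg_neg _)

theorem isPlusMinus_sub_comm {T : ℕ} {a b : ZMod m} :
    IsPlusMinus T (a - b) ↔ IsPlusMinus T (b - a) :=
  ⟨fun h => by simpa using h.neg, fun h => by simpa using h.neg⟩

theorem IsPlusMinus.double {T : ℕ} {a : ZMod m} (h : IsPlusMinus T a) :
    IsPlusMinus (2 * T) (a + a) := by
  rcases h with rfl | rfl
  · left; push_cast; ring
  · right; push_cast; ring

theorem IsPlusMinus.add_of_ne_zero {T : ℕ} {a b : ZMod m} (ha : IsPlusMinus T a)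
    (hb : IsPlusMinus T b) (h : a + b ≠ 0) : IsPlusMinus (2 * T) (a + b) := by
  rcases ha with rfl | rfl <;> rcases hb with rfl | rfl
  · left; push_cast; ring
  · simp at h
  · simp at h
  · right; push_cast; ring

theorem IsPlusMinus.exists_half {T : ℕ} {a : ZMod m} (h : IsPlusMinus (2 * T) a) :
    ∃ c, IsPlusMinus T c ∧ a = c + c := by
  rcases h with rfl | rfl
  · exact ⟨T, Or.inl rfl, by push_cast; ring⟩
  · exact ⟨-T, Or.inr rfl, by push_cast; ring⟩

theorem cycNorm_add_le (a b : ZMod m) : cycNorm (a + b) ≤ cycNorm a + cycNorm b :=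
  (ZMod.natAbs_valMinAbs_add_le a b).trans (Int.natAbs_add_le _ _)

theorem cycNorm_sub_le (a b c : ZMod m) : cycNorm (b - a) ≤ cycNorm (c - a) + cycNorm (b - c) := by
  rw [show b - a = (c - a) + (b - c) by ring]
  exact cycNorm_add_le _ _

theorem cycNorm_le_half [NeZero m] (a : ZMod m) : cycNorm a ≤ m / 2 := ZMod.natAbs_valMinAbs_le a

theorem cycNorm_eq_zero {a : ZMod m} : cycNorm a = 0 ↔ a = 0 := by
  rw [cycNorm, Int.natAbs_eq_zero, ZMod.valMinAbs_eq_zero]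

theorem isPlusMinus_cycNorm (a : ZMod m) : IsPlusMinus (cycNorm a) a := by
  have h := ZMod.coe_valMinAbs a
  rcases Int.natAbs_eq a.valMinAbs with h' | h'
  · left
    conv_lhs => rw [← h, h']
    simp [cycNorm]
  · right
    conv_lhs => rw [← h, h']
    simp [cycNorm]

theorem cycNorm_natCast {T : ℕ} (h : T ≤ m / 2) : cycNorm (T : ZMod m) = T := by
  rw [cycNorm, ZMod.valMinAbs_natCast_of_le_half h, Int.natAbs_natCast]

theorem IsPlusMinus.cycNorm_eq_natCast {T : ℕ} {a : ZMod m} (h : IsPlusMinus T a) :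
    cycNorm a = cycNorm (T : ZMod m) := by
  rcases h with rfl | rfl
  · rfl
  · exact cycNorm_neg _

theorem IsPlusMinus.cycNorm_eq {T : ℕ} {a : ZMod m} (h : IsPlusMinus T a) (hT : T ≤ m / 2) :
    cycNorm a = T := by
  rw [h.cycNorm_eq_natCast, cycNorm_natCast hT]

theorem cycNorm_eq_iff {T : ℕ} {a : ZMod m} (hT : T ≤ m / 2) :
    cycNorm a = T ↔ IsPlusMinus T a :=
  ⟨fun h => h ▸ isPlusMinus_cycNorm a, fun h => h.cycNorm_eq hT⟩

theorem cycNorm_natCast_of_half_lt {T : ℕ} (h1 : m / 2 < T) (h2 : T ≤ m) :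
    cycNorm (T : ZMod m) = m - T := by
  have : (T : ZMod m) = -((m - T : ℕ) : ZMod m) := by
    rw [Nat.cast_sub h2]; simp
  rw [this, cycNorm_neg, cycNorm_natCast (by omega)]

/-- A geodesic in the cycle has points at all intermediate distances. -/
theorem exists_cycNorm_split [NeZero m] {a b : ZMod m} {p q : ℕ} (h : cycNorm (b - a) = p + q) :
    ∃ c, cycNorm (c - a) = p ∧ cycNorm (b - c) = q := by
  have hle := cycNorm_le_half (b - a)
  rw [h] at hle
  have hpm := isPlusMinus_cycNorm (b - a)
  rw [h] at hpm
  rcases hpm with h' | h'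
  · refine ⟨a + p, ?_, ?_⟩
    · rw [add_sub_cancel_left, cycNorm_natCast (by omega)]
    · rw [show b - (a + p) = (q : ZMod m) by linear_combination h' + Nat.cast_add (R := ZMod m) p q,
        cycNorm_natCast (by omega)]
  · refine ⟨a - p, ?_, ?_⟩
    · rw [show a - p - a = -(p : ZMod m) by ring, cycNorm_neg, cycNorm_natCast (by omega)]
    · rw [show b - (a - p) = -(q : ZMod m) by linear_combination h' - Nat.cast_add (R := ZMod m) p q,
        cycNorm_neg, cycNorm_natCast (by omega)]

/-- As `T` may exceed `m / 2`, the norm of `±T` can also be `m - T`; the second hypothesis rules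
this out. -/
theorem not_isPlusMinus {T : ℕ} {a : ZMod m} (hne : cycNorm a ≠ T) (hlt : cycNorm a + T < m) :
    ¬ IsPlusMinus T a := by
  intro h
  rcases Nat.lt_or_ge (m / 2) T with hT | hT
  · have := h.cycNorm_eq_natCast
    rw [cycNorm_natCast_of_half_lt hT (by omega)] at this
    omega
  · exact hne (h.cycNorm_eq hT)

end CyclicNorm

/-! ### The metamour graph of `G(m, 2)`, and composing and splitting the relations `reach`. -/

section Petersen

variable {m : ℕ}

theorem generalizedPetersen_two_adj_inl_inl (hm : 5 ≤ m) {a b : ZMod m} :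
    (generalizedPetersen m 2).Adj (.inl a) (.inl b) ↔ IsPlusMinus 1 (b - a) := by
  have : Fact (1 < m) := ⟨by omega⟩
  simp only [generalizedPetersen, SimpleGraph.fromRel_adj, IsPlusMinus, Sum.inl.injEq, reduceCtorEq,
    and_false, exists_false, or_false, ne_eq, Nat.cast_one]
  constructor
  · rintro ⟨-, ⟨i, rfl, rfl⟩ | ⟨i, rfl, rfl⟩⟩
    · left; ring
    · right; ring
  · rintro (h | h)
    · obtain rfl : b = a + 1 := by linear_combination h
      exact ⟨by simp, Or.inl ⟨a, rfl, rfl⟩⟩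
    · obtain rfl : a = b + 1 := by linear_combination -h
      exact ⟨by simp, Or.inr ⟨b, rfl, rfl⟩⟩

theorem generalizedPetersen_two_adj_inl_inr {a b : ZMod m} :
    (generalizedPetersen m 2).Adj (.inl a) (.inr b) ↔ a = b := by
  simp only [generalizedPetersen, SimpleGraph.fromRel_adj, Sum.inl.injEq, Sum.inr.injEq,
    reduceCtorEq, false_and, and_false, exists_false, or_false, false_or, ne_eq, not_false_eq_true,
    true_and]
  exact ⟨fun ⟨i, h1, h2⟩ => h1.trans h2.symm, fun h => ⟨a, rfl, h.symm⟩⟩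

theorem generalizedPetersen_two_adj_inr_inr (hm : 5 ≤ m) {a b : ZMod m} :
    (generalizedPetersen m 2).Adj (.inr a) (.inr b) ↔ IsPlusMinus 2 (b - a) := by
  have : NeZero m := ⟨by omega⟩
  have h2 : ((2 : ℕ) : ZMod m) ≠ 0 := by
    rw [Ne, ← cycNorm_eq_zero, cycNorm_natCast (by omega)]; omega
  simp only [generalizedPetersen, SimpleGraph.fromRel_adj, IsPlusMinus, Sum.inr.injEq, reduceCtorEq,
    false_and, and_false, exists_false, false_or, ne_eq]
  constructor
  · rintro ⟨-, ⟨i, rfl, rfl⟩ | ⟨i, rfl, rfl⟩⟩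
    · left; ring
    · right; ring
  · rintro (h | h)
    · obtain rfl : b = a + (2 : ℕ) := by linear_combination h
      exact ⟨by simpa using h2, Or.inl ⟨a, rfl, rfl⟩⟩
    · obtain rfl : a = b + (2 : ℕ) := by linear_combination -h
      exact ⟨by simpa using h2, Or.inr ⟨b, rfl, rfl⟩⟩

theorem metamour_petersen_inl_inl (hm : 5 ≤ m) {a b : ZMod m} :
    (metamour (generalizedPetersen m 2)).Adj (.inl a) (.inl b) ↔ cycNorm (b - a) = 2 := by
  have : NeZero m := ⟨by omega⟩
  rw [metamour_adj_iff]
  constructor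
  · rintro ⟨hne, -, c | c, h1, h2⟩
    · rw [generalizedPetersen_two_adj_inl_inl hm] at h1 h2
      rw [cycNorm_eq_iff (by omega), show b - a = (c - a) + (b - c) by ring]
      refine h1.add_of_ne_zero h2 fun h => hne ?_
      rw [show b = a by linear_combination h]
    · rw [generalizedPetersen_two_adj_inl_inr] at h1
      rw [SimpleGraph.adj_comm, generalizedPetersen_two_adj_inl_inr] at h2
      exact absurd (by rw [h1, h2]) hne
  · intro h
    obtain ⟨c, h1, h2⟩ := exists_cycNorm_split (p := 1) (q := 1) h
    refine ⟨?_, ?_, .inl c, ?_, ?_⟩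
    · rintro h'
      obtain rfl := Sum.inl_injective h'
      rw [sub_self, cycNorm_eq_zero.mpr rfl] at h
      omega
    · rw [generalizedPetersen_two_adj_inl_inl hm, ← cycNorm_eq_iff (by omega)]; omega
    · rwa [generalizedPetersen_two_adj_inl_inl hm, ← cycNorm_eq_iff (by omega)]
    · rwa [generalizedPetersen_two_adj_inl_inl hm, ← cycNorm_eq_iff (by omega)]

theorem metamour_petersen_inl_inr (hm : 5 ≤ m) {a b : ZMod m} :
    (metamour (generalizedPetersen m 2)).Adj (.inl a) (.inr b) ↔
      cycNorm (b - a) = 1 ∨ cycNorm (b - a) = 2 := by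
  have : NeZero m := ⟨by omega⟩
  rw [metamour_adj_iff]
  constructor
  · rintro ⟨-, -, c | c, h1, h2⟩
    · rw [generalizedPetersen_two_adj_inl_inr] at h2
      rw [generalizedPetersen_two_adj_inl_inl hm, h2] at h1
      exact Or.inl (h1.cycNorm_eq (by omega))
    · rw [generalizedPetersen_two_adj_inl_inr] at h1
      rw [generalizedPetersen_two_adj_inr_inr hm, ← h1] at h2
      exact Or.inr (h2.cycNorm_eq (by omega))
  · intro h
    refine ⟨Sum.inl_ne_inr, ?_, ?_⟩
    · rw [generalizedPetersen_two_adj_inl_inr]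
      rintro rfl
      rw [sub_self, cycNorm_eq_zero.mpr rfl] at h
      omega
    · rcases h with h | h
      · refine ⟨.inl b, ?_, generalizedPetersen_two_adj_inl_inr.mpr rfl⟩
        rwa [generalizedPetersen_two_adj_inl_inl hm, ← cycNorm_eq_iff (by omega)]
      · refine ⟨.inr a, generalizedPetersen_two_adj_inl_inr.mpr rfl, ?_⟩
        rwa [generalizedPetersen_two_adj_inr_inr hm, ← cycNorm_eq_iff (by omega)]

/-- Two interior steps in the same direction give `±4`. For `m = 6` this is `∓2`, an edge. For `m <
8` the residue `±4` has norm below 4, so a norm condition would be wrong. -/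
theorem metamour_petersen_inr_inr (hm : 5 ≤ m) {a b : ZMod m} :
    (metamour (generalizedPetersen m 2)).Adj (.inr a) (.inr b) ↔
      m ≠ 6 ∧ IsPlusMinus 4 (b - a) := by
  have : NeZero m := ⟨by omega⟩
  have hnorm : IsPlusMinus 4 (b - a) → (cycNorm (b - a) = 2 ↔ m = 6) ∧ cycNorm (b - a) ≠ 0 := by
    intro h
    rcases Nat.lt_or_ge (m / 2) 4 with h4 | h4
    · rw [h.cycNorm_eq_natCast, cycNorm_natCast_of_half_lt h4 (by omega)]; omega
    · rw [h.cycNorm_eq h4]; omega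
  rw [metamour_adj_iff, generalizedPetersen_two_adj_inr_inr hm, ← cycNorm_eq_iff (by omega)]
  constructor
  · rintro ⟨hne, hna, c | c, h1, h2⟩
    · rw [SimpleGraph.adj_comm, generalizedPetersen_two_adj_inl_inr] at h1
      rw [generalizedPetersen_two_adj_inl_inr] at h2
      exact absurd (by rw [← h1, h2]) hne
    · rw [generalizedPetersen_two_adj_inr_inr hm] at h1 h2
      have h4 : IsPlusMinus 4 (b - a) := by
        rw [show b - a = (c - a) + (b - c) by ring]
        refine h1.add_of_ne_zero h2 fun h => hne ?_
        rw [show b = a by linear_combination h]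
      exact ⟨fun h6 => hna ((hnorm h4).1.mpr h6), h4⟩
  · rintro ⟨h6, h4⟩
    obtain ⟨d, hd, e⟩ := IsPlusMinus.exists_half (T := 2) h4
    refine ⟨?_, fun h => h6 ((hnorm h4).1.mp h), .inr (a + d), ?_, ?_⟩
    · rintro h'
      obtain rfl := Sum.inr_injective h'
      exact (hnorm h4).2 (by rw [sub_self, cycNorm_eq_zero])
    · rw [generalizedPetersen_two_adj_inr_inr hm, add_sub_cancel_left]
      exact hd
    · rw [generalizedPetersen_two_adj_inr_inr hm, show b - (a + d) = d by linear_combination e]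
      exact hd

theorem cycNorm_add_self_of_eq_one (hm : 5 ≤ m) {d : ZMod m} (h : cycNorm d = 1) :
    cycNorm (d + d) = 2 := by
  have : NeZero m := ⟨by omega⟩
  exact IsPlusMinus.cycNorm_eq ((cycNorm_eq_iff (by omega)).mp h).double (by omega)

theorem exists_metamour_of_petersen_adj (hm : 5 ≤ m) (x y : ZMod m ⊕ ZMod m)
    (h : (generalizedPetersen m 2).Adj x y) :
    ∃ z, (metamour (generalizedPetersen m 2)).Adj x z ∧
      (metamour (generalizedPetersen m 2)).Adj z y := by
  have : NeZero m := ⟨by omega⟩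
  have hvu : ∀ a b : ZMod m, (generalizedPetersen m 2).Adj (.inl a) (.inr b) →
      ∃ z, (metamour (generalizedPetersen m 2)).Adj (.inl a) z ∧
        (metamour (generalizedPetersen m 2)).Adj z (.inr b) := by
    intro a b h
    rw [generalizedPetersen_two_adj_inl_inr] at h
    subst h
    have h2 := cycNorm_natCast (m := m) (T := 2) (by omega)
    refine ⟨.inl (a + (2 : ℕ)), ?_, ?_⟩
    · rw [metamour_petersen_inl_inl hm, add_sub_cancel_left, h2]
    · rw [metamour_petersen_inl_inr hm, cycNorm_sub_comm, add_sub_cancel_left, h2]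
      exact Or.inr rfl
  rcases x with a | a <;> rcases y with b | b
  · rw [generalizedPetersen_two_adj_inl_inl hm, ← cycNorm_eq_iff (by omega)] at h
    refine ⟨.inr (a + ((b - a) + (b - a))), ?_, ?_⟩
    · rw [metamour_petersen_inl_inr hm, add_sub_cancel_left]
      exact Or.inr (cycNorm_add_self_of_eq_one hm h)
    · rw [SimpleGraph.adj_comm, metamour_petersen_inl_inr hm,
        show a + ((b - a) + (b - a)) - b = b - a by ring]
      exact Or.inl h
  · exact hvu a b h
  · obtain ⟨z, h1, h2⟩ := hvu b a h.symm
    exact ⟨z, h2.symm, h1.symm⟩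
  · rw [generalizedPetersen_two_adj_inr_inr hm, ← cycNorm_eq_iff (by omega)] at h
    obtain ⟨c, h1, h2⟩ := exists_cycNorm_split (p := 1) (q := 1) h
    refine ⟨.inl c, ?_, ?_⟩
    · rw [SimpleGraph.adj_comm, metamour_petersen_inl_inr hm, cycNorm_sub_comm]
      exact Or.inl h1
    · rw [metamour_petersen_inl_inr hm]
      exact Or.inl h2

theorem twoStep_one_of_metamour_petersen (hm : 5 ≤ m) (x y : ZMod m ⊕ ZMod m)
    (h : twoStep (generalizedPetersen m 2) 0 x y) : twoStep (generalizedPetersen m 2) 1 x y := by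
  have : NeZero m := ⟨by omega⟩
  have hvu : ∀ a b : ZMod m, twoStep (generalizedPetersen m 2) 0 (.inl a) (.inr b) →
      twoStep (generalizedPetersen m 2) 1 (.inl a) (.inr b) := by
    intro a b h
    refine ⟨h.ne, ?_⟩
    rcases (metamour_petersen_inl_inr hm).mp h with h | h
    · refine ⟨.inl (a + ((b - a) + (b - a))), ?_, ?_⟩
      · refine (metamour_petersen_inl_inl hm).mpr ?_
        rw [add_sub_cancel_left]
        exact cycNorm_add_self_of_eq_one hm h
      · refine (metamour_petersen_inl_inr hm).mpr (Or.inl ?_)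
        rwa [cycNorm_sub_comm, show a + ((b - a) + (b - a)) - b = b - a by ring]
    · have hd : IsPlusMinus 2 (b - a) := (cycNorm_eq_iff (by omega)).mp h
      -- Stepping back by the difference `d = ±2` leaves `2d = ±4`. An interior vertex serves as
      -- midpoint unless `m = 6`, where `2d` has norm 2 and an exterior one works.
      by_cases h6 : m = 6
      · refine ⟨.inl (a - (b - a)), ?_, ?_⟩
        · refine (metamour_petersen_inl_inl hm).mpr ?_
          rwa [sub_sub_cancel_left, cycNorm_neg]
        · refine (metamour_petersen_inl_inr hm).mpr (Or.inr ?_)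
          rw [show b - (a - (b - a)) = (b - a) + (b - a) by ring, hd.double.cycNorm_eq_natCast,
            cycNorm_natCast_of_half_lt (by omega) (by omega)]
          omega
      · refine ⟨.inr (a - (b - a)), ?_, ?_⟩
        · refine (metamour_petersen_inl_inr hm).mpr (Or.inr ?_)
          rwa [sub_sub_cancel_left, cycNorm_neg]
        · refine (metamour_petersen_inr_inr hm).mpr ⟨h6, ?_⟩
          rw [show b - (a - (b - a)) = (b - a) + (b - a) by ring]
          exact hd.double
  rcases x with a | a <;> rcases y with b | b
  · refine ⟨h.ne, ?_⟩
    obtain ⟨c, h1, h2⟩ := exists_cycNorm_split (p := 1) (q := 1)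
      ((metamour_petersen_inl_inl hm).mp h)
    refine ⟨.inr c, (metamour_petersen_inl_inr hm).mpr (Or.inl h1), twoStep.symm ?_⟩
    exact (metamour_petersen_inl_inr hm).mpr (Or.inl (by rwa [cycNorm_sub_comm]))
  · exact hvu a b h
  · exact (hvu b a h.symm).symm
  · refine ⟨h.ne, ?_⟩
    obtain ⟨d, hd, e⟩ := IsPlusMinus.exists_half (T := 2) ((metamour_petersen_inr_inr hm).mp h).2
    have hd2 := hd.cycNorm_eq (by omega)
    refine ⟨.inl (a + d), twoStep.symm ?_, ?_⟩
    · refine (metamour_petersen_inl_inr hm).mpr (Or.inr ?_)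
      rw [cycNorm_sub_comm, add_sub_cancel_left, hd2]
    · refine (metamour_petersen_inl_inr hm).mpr (Or.inr ?_)
      rw [show b - (a + d) = d by linear_combination e, hd2]

/-- The pairs of vertices of `G(m, 2)` joined by a 2-walk of a given length `≥ 2` are the distinct
pairs in `reach R` for a suitable radius `R`; `reach 0` contains the metamour graph. -/
def reach (R : ℕ) : ZMod m ⊕ ZMod m → ZMod m ⊕ ZMod m → Prop
  | .inl a, .inl b => cycNorm (b - a) ≤ R ∨ cycNorm (b - a) = 2
  | .inl a, .inr b => cycNorm (b - a) ≤ R + 2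
  | .inr a, .inl b => cycNorm (b - a) ≤ R + 2
  | .inr a, .inr b => cycNorm (b - a) ≤ R ∨ IsPlusMinus (R + 4) (b - a)

theorem reach_symm {R : ℕ} {x y : ZMod m ⊕ ZMod m} (h : reach R x y) : reach R y x := by
  rcases x with a | a <;> rcases y with b | b <;> simp only [reach] at h ⊢ <;>
    rw [cycNorm_sub_comm] <;> first | exact h | rwa [isPlusMinus_sub_comm]

/-- The triangle inequality suffices except for two exceptional interior jumps `±(R + 4)`: they
cancel, or add up to the exceptional jump `±(2 * R + 8)` of the new radius. -/
theorem reach_comp {R : ℕ} [NeZero m] {x y z : ZMod m ⊕ ZMod m} (h1 : reach R x z)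
    (h2 : reach R z y) : reach (2 * R + 4) x y := by
  have hlarge : ∀ d : ZMod m, cycNorm d ≤ R ∨ IsPlusMinus (R + 4) d → cycNorm d ≤ R + 4 := by
    rintro d (h | h)
    · omega
    · rw [h.cycNorm_eq_natCast]
      rcases Nat.lt_or_ge (m / 2) (R + 4) with h' | h'
      · exact (cycNorm_le_half _).trans h'.le
      · exact (cycNorm_natCast h').le
  rcases x with a | a <;> rcases y with b | b <;> rcases z with c | c <;>
    simp only [reach] at h1 h2 ⊢ <;> have := cycNorm_sub_le a b c
  · omega
  · omega
  · omega
  · have := hlarge _ h2; omega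
  · omega
  · have := hlarge _ h1; omega
  · omega
  · rcases h1 with h1 | h1
    · have := hlarge _ h2; left; omega
    · rcases h2 with h2 | h2
      · have := hlarge _ (Or.inr h1); left; omega
      · by_cases h0 : (c - a) + (b - c) = 0
        · left
          rw [show b - a = (c - a) + (b - c) by ring, h0, cycNorm_eq_zero.mpr rfl]
          omega
        · right
          have := h1.add_of_ne_zero h2 h0
          rwa [show 2 * (R + 4) = 2 * R + 4 + 4 by ring, show (c - a) + (b - c) = b - a by ring]
            at this

/-- A pair that is new at radius `2 * R + 4` splits into two pairs that are new at radius `R`. The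
midpoint lies on a geodesic of the cycle, or in the middle of a double exceptional jump; its side is
chosen so that neither half already lies in `reach S`. -/
theorem exists_midpoint {S R : ℕ} [NeZero m] (hS : S ≠ 1) (hR : R = 2 * S + 4) {x y : ZMod m ⊕ ZMod m}
    (h : reach (2 * R + 4) x y) (hn : ¬ reach R x y) :
    ∃ z, (reach R x z ∧ ¬ reach S x z) ∧ (reach R z y ∧ ¬ reach S z y) := by
  have hvu : ∀ a b : ZMod m, reach (2 * R + 4) (.inl a) (.inr b) → ¬ reach R (.inl a) (.inr b) →
      ∃ z : ZMod m ⊕ ZMod m, (reach R (.inl a) z ∧ ¬ reach S (.inl a) z) ∧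
        (reach R z (.inr b) ∧ ¬ reach S z (.inr b)) := by
    intro a b h hn
    simp only [reach] at h hn
    have hm := cycNorm_le_half (b - a)
    generalize hN : cycNorm (b - a) = N at h hn hm
    rcases Nat.lt_or_ge (2 * R + 2) N with h1 | h1
    -- Long distances need the exceptional interior jump `R + 4`.
    · obtain ⟨c, hp, hq⟩ := exists_cycNorm_split (a := a) (b := b) (p := N - (R + 4))
        (q := R + 4) (by omega)
      refine ⟨.inr c, ⟨?_, ?_⟩, ?_, ?_⟩ <;> simp only [reach]
      · omega
      · omega
      · exact Or.inr ((cycNorm_eq_iff (by omega)).mp hq)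
      · rintro (h' | h')
        · omega
        · exact not_isPlusMinus (by omega) (by omega) h'
    · obtain ⟨p, q, hpq, h2, h3, h4, h5, h6⟩ : ∃ p q, p + q = N ∧ S + 3 ≤ p ∧ p ≤ R ∧
          S + 3 ≤ q ∧ q ≤ R + 2 ∧ p ≠ 2 := by
        rcases Nat.lt_or_ge (3 * S + 7) N with h2 | h2
        · exact ⟨R, N - R, by omega⟩
        · exact ⟨N - (S + 3), S + 3, by omega⟩
      obtain ⟨c, hp, hq⟩ := exists_cycNorm_split (a := a) (b := b) (p := p) (q := q) (by omega)
      refine ⟨.inl c, ⟨?_, ?_⟩, ?_, ?_⟩ <;> simp only [reach] <;> omega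
  rcases x with a | a <;> rcases y with b | b
  · simp only [reach] at h hn
    have hm := cycNorm_le_half (b - a)
    generalize hN : cycNorm (b - a) = N at h hn hm
    -- Halving through an interior vertex would leave a half `S + 2`, which is not new. An exterior
    -- midpoint with `S + 1` and `S + 4` works; `S ≠ 1` keeps `S + 1` away from the exceptional
    -- distance 2.
    by_cases h1 : N = 2 * S + 5
    · obtain ⟨c, hp, hq⟩ := exists_cycNorm_split (a := a) (b := b) (p := S + 1)
        (q := S + 4) (by omega)
      refine ⟨.inl c, ⟨?_, ?_⟩, ?_, ?_⟩ <;> simp only [reach] <;> omega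
    · obtain ⟨c, hp, hq⟩ := exists_cycNorm_split (a := a) (b := b) (p := N / 2)
        (q := N - N / 2) (by omega)
      refine ⟨.inr c, ⟨?_, ?_⟩, ?_, ?_⟩ <;> simp only [reach] <;> omega
  · exact hvu a b h hn
  · obtain ⟨z, ⟨h1, h2⟩, h3, h4⟩ := hvu b a (reach_symm h) fun h => hn (reach_symm h)
    exact ⟨z, ⟨reach_symm h3, fun h => h4 (reach_symm h)⟩, reach_symm h1,
      fun h => h2 (reach_symm h)⟩
  · simp only [reach] at h hn
    have hm := cycNorm_le_half (b - a)
    push Not at hn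
    obtain ⟨hn1, hn2⟩ := hn
    have hn3 : cycNorm (b - a) ≠ R + 4 := fun h => hn2 ((cycNorm_eq_iff (by omega)).mp h)
    by_cases h0 : cycNorm (b - a) ≤ 2 * R + 4
    · generalize hN : cycNorm (b - a) = N at h hn1 hn3 hm h0
      by_cases h1 : N = 2 * S + 5
      -- Between interior vertices `S + 4` is not new, hence the split `S + 2`, `S + 3`.
      · obtain ⟨c, hp, hq⟩ := exists_cycNorm_split (a := a) (b := b) (p := S + 2)
          (q := S + 3) (by omega)
        refine ⟨.inr c, ⟨?_, ?_⟩, ?_, ?_⟩ <;> simp only [reach]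
        · omega
        · rintro (h' | h')
          · omega
          · exact not_isPlusMinus (by omega) (by omega) h'
        · omega
        · rintro (h' | h')
          · omega
          · exact not_isPlusMinus (by omega) (by omega) h'
      · obtain ⟨c, hp, hq⟩ := exists_cycNorm_split (a := a) (b := b) (p := N / 2)
          (q := N - N / 2) (by omega)
        refine ⟨.inl c, ⟨?_, ?_⟩, ?_, ?_⟩ <;> simp only [reach]
        · omega
        · omega
        · omega
        · omega
    · have h8 : IsPlusMinus (2 * (R + 4)) (b - a) := by
        rcases h with h | h
        · omega
        · rwa [show 2 * (R + 4) = 2 * R + 4 + 4 by ring]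
      obtain ⟨d, hd, e⟩ := h8.exists_half
      -- Even if `2 * R + 8` wraps around, its norm `m - (2 * R + 8)` exceeds `2 * R + 4`, so `m` is
      -- large and the half `±(R + 4)` does not wrap.
      have hm2 : 2 * R + 6 ≤ m / 2 := by
        have hN := h8.cycNorm_eq_natCast
        rcases Nat.lt_or_ge (m / 2) (2 * (R + 4)) with h' | h'
        · rcases Nat.lt_or_ge m (2 * (R + 4)) with h'' | h''
          · omega
          · rw [cycNorm_natCast_of_half_lt h' h''] at hN
            omega
        · omega
      have hdn := hd.cycNorm_eq (by omega)
      have hSd : ¬ (cycNorm d ≤ S ∨ IsPlusMinus (S + 4) d) := by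
        rintro (h' | h')
        · omega
        · exact not_isPlusMinus (by omega) (by omega) h'
      refine ⟨.inr (a + d), ?_, ?_⟩ <;> simp only [reach]
      · rw [add_sub_cancel_left]
        exact ⟨Or.inr hd, hSd⟩
      · rw [show b - (a + d) = d by linear_combination e]
        exact ⟨Or.inr hd, hSd⟩

end Petersen

/-! ### Identification of `twoStep` with `reach`, and birth levels in `G(m, 2)`. -/

section Limit

variable {m : ℕ}

/-- The radii for which `reach` describes 2-walks of length `1, 2, 3, …`. -/
def walkRadius : ℕ → ℕ
  | 0 => 0
  | n + 1 => 2 * walkRadius n + 4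

theorem four_mul_le_walkRadius (n : ℕ) : 4 * n ≤ walkRadius n := by
  induction n with
  | zero => simp
  | succ n ih => simp only [walkRadius]; omega

theorem reach_of_twoStep (hm : 5 ≤ m) {n : ℕ} {x y : ZMod m ⊕ ZMod m}
    (h : twoStep (generalizedPetersen m 2) n x y) : reach (walkRadius n) x y := by
  have : NeZero m := ⟨by omega⟩
  induction n generalizing x y with
  | zero =>
    rcases x with a | a <;> rcases y with b | b <;> simp only [reach, walkRadius]
    · exact Or.inr ((metamour_petersen_inl_inl hm).mp h)
    · have := (metamour_petersen_inl_inr hm).mp h; omega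
    · have := (metamour_petersen_inl_inr hm).mp h.symm
      rw [cycNorm_sub_comm]; omega
    · exact Or.inr ((metamour_petersen_inr_inr hm).mp h).2
  | succ n ih =>
    obtain ⟨-, z, h1, h2⟩ := h
    exact reach_comp (ih h1) (ih h2)

/-- The converse of `reach_of_twoStep` starts only at level 1: `reach 0` also contains the edges
`v_i u_i`, which are not metamour pairs. So this base case is done by hand. -/
theorem twoStep_one_of_reach (hm : 5 ≤ m) {x y : ZMod m ⊕ ZMod m} (hne : x ≠ y)
    (h : reach 4 x y) : twoStep (generalizedPetersen m 2) 1 x y := by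
  have : NeZero m := ⟨by omega⟩
  have vv : ∀ {a b : ZMod m}, cycNorm (b - a) = 2 →
      twoStep (generalizedPetersen m 2) 0 (.inl a) (.inl b) :=
    fun h => (metamour_petersen_inl_inl hm).mpr h
  have vu : ∀ {a b : ZMod m}, cycNorm (b - a) = 1 ∨ cycNorm (b - a) = 2 →
      twoStep (generalizedPetersen m 2) 0 (.inl a) (.inr b) :=
    fun h => (metamour_petersen_inl_inr hm).mpr h
  have uv : ∀ {a b : ZMod m}, cycNorm (b - a) = 1 ∨ cycNorm (b - a) = 2 →
      twoStep (generalizedPetersen m 2) 0 (.inr a) (.inl b) :=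
    fun h => (vu (by rwa [cycNorm_sub_comm])).symm
  have uu : m ≠ 6 → ∀ {a b : ZMod m}, IsPlusMinus 4 (b - a) →
      twoStep (generalizedPetersen m 2) 0 (.inr a) (.inr b) :=
    fun h6 _ _ h => (metamour_petersen_inr_inr hm).mpr ⟨h6, h⟩
  -- Distance 1 is realized by overshooting: two forward, one back.
  have one : ∀ {a b : ZMod m}, cycNorm (b - a) = 1 → ∃ c, cycNorm (c - a) = 2 ∧
      cycNorm (b - c) = 1 := by
    intro a b h
    refine ⟨a + ((b - a) + (b - a)), ?_, ?_⟩
    · rw [add_sub_cancel_left]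
      exact cycNorm_add_self_of_eq_one hm h
    · rw [cycNorm_sub_comm, show a + ((b - a) + (b - a)) - b = b - a by ring]
      exact h
  have hvu : ∀ a b : ZMod m, reach 4 (.inl a) (.inr b) →
      twoStep (generalizedPetersen m 2) 1 (.inl a) (.inr b) := by
    intro a b h
    simp only [reach] at h
    have hle := cycNorm_le_half (b - a)
    by_cases h0 : cycNorm (b - a) = 0
    · rw [cycNorm_eq_zero, sub_eq_zero] at h0
      subst h0
      have h2 := cycNorm_natCast (m := m) (T := 2) (by omega)
      exact ⟨Sum.inl_ne_inr, .inl (b + (2 : ℕ)), vv (by rwa [add_sub_cancel_left]),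
        vu (by rw [cycNorm_sub_comm, add_sub_cancel_left]; exact Or.inr h2)⟩
    by_cases h12 : cycNorm (b - a) ≤ 2
    · exact twoStep_one_of_metamour_petersen hm _ _ (vu (by omega))
    by_cases h34 : cycNorm (b - a) ≤ 4
    · obtain ⟨c, hp, hq⟩ := exists_cycNorm_split (a := a) (b := b) (p := 2)
        (q := cycNorm (b - a) - 2) (by omega)
      exact ⟨Sum.inl_ne_inr, .inl c, vv hp, vu (by omega)⟩
    · obtain ⟨c, hp, hq⟩ := exists_cycNorm_split (a := a) (b := b)
        (p := cycNorm (b - a) - 4) (q := 4) (by omega)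
      exact ⟨Sum.inl_ne_inr, .inr c, vu (by omega),
        uu (by omega) ((cycNorm_eq_iff (by omega)).mp hq)⟩
  rcases x with a | a <;> rcases y with b | b
  · simp only [reach] at h
    have h0 : cycNorm (b - a) ≠ 0 := fun h0 => hne (by
      rw [cycNorm_eq_zero, sub_eq_zero] at h0; rw [h0])
    refine ⟨hne, ?_⟩
    by_cases h1 : cycNorm (b - a) = 1
    · obtain ⟨c, hp, hq⟩ := one h1
      exact ⟨.inr c, vu (by omega), uv (by omega)⟩
    · obtain ⟨c, hp, hq⟩ := exists_cycNorm_split (a := a) (b := b)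
        (p := cycNorm (b - a) / 2) (q := cycNorm (b - a) - cycNorm (b - a) / 2) (by omega)
      exact ⟨.inr c, vu (by omega), uv (by omega)⟩
  · exact hvu a b h
  · exact (hvu b a (reach_symm h)).symm
  · simp only [reach] at h
    have h0 : cycNorm (b - a) ≠ 0 := fun h0 => hne (by
      rw [cycNorm_eq_zero, sub_eq_zero] at h0; rw [h0])
    refine ⟨hne, ?_⟩
    by_cases h1 : cycNorm (b - a) = 1
    · obtain ⟨c, hp, hq⟩ := one h1
      exact ⟨.inl c, uv (by omega), vu (by omega)⟩
    by_cases h4 : cycNorm (b - a) ≤ 4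
    · obtain ⟨c, hp, hq⟩ := exists_cycNorm_split (a := a) (b := b)
        (p := cycNorm (b - a) / 2) (q := cycNorm (b - a) - cycNorm (b - a) / 2) (by omega)
      exact ⟨.inl c, uv (by omega), vu (by omega)⟩
    · have := cycNorm_le_half (b - a)
      obtain ⟨d, hd, e⟩ := IsPlusMinus.exists_half (T := 4) (h.resolve_left h4)
      refine ⟨.inr (a + d), uu (by omega) ?_, uu (by omega) ?_⟩
      · rwa [add_sub_cancel_left]
      · rwa [show b - (a + d) = d by linear_combination e]

theorem walkRadius_ne_one (n : ℕ) : walkRadius n ≠ 1 := by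
  cases n <;> simp only [walkRadius] <;> omega

theorem twoStep_succ_of_reach (hm : 5 ≤ m) {n : ℕ} {x y : ZMod m ⊕ ZMod m} (hne : x ≠ y)
    (h : reach (walkRadius (n + 1)) x y) : twoStep (generalizedPetersen m 2) (n + 1) x y := by
  have : NeZero m := ⟨by omega⟩
  induction n generalizing x y with
  | zero => exact twoStep_one_of_reach hm hne h
  | succ n ih =>
    by_cases hn : reach (walkRadius (n + 1)) x y
    · exact twoStep_mono (twoStep_one_of_metamour_petersen hm) (Nat.le_succ _) (ih hne hn)
    · obtain ⟨z, ⟨h1, -⟩, h2, -⟩ := exists_midpoint (walkRadius_ne_one n) rfl h hn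
      refine ⟨hne, z, ih ?_ h1, ih ?_ h2⟩
      · rintro rfl; exact hn h2
      · rintro rfl; exact hn h1

/-- The halves given by `exists_midpoint` lie in the radius of level `n + 1` but not of level `n`,
so induction applies to them. Excluding level `n` uses only `reach_of_twoStep`, which also holds at
level 0. -/
theorem fullMin_succ_of_twoStep_petersen (hm : 5 ≤ m) (n : ℕ) (x y : ZMod m ⊕ ZMod m)
    (h : twoStep (generalizedPetersen m 2) (n + 1) x y)
    (hn : ¬ twoStep (generalizedPetersen m 2) n x y) :
    fullMin (generalizedPetersen m 2) (n + 1) x y := by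
  have : NeZero m := ⟨by omega⟩
  induction n generalizing x y with
  | zero => exact ⟨h.1, h.2, hn⟩
  | succ n ih =>
    have hr : ¬ reach (walkRadius (n + 1)) x y := fun h' => hn (twoStep_succ_of_reach hm h.ne h')
    obtain ⟨z, ⟨h1, h2⟩, h3, h4⟩ :=
      exists_midpoint (walkRadius_ne_one n) rfl (reach_of_twoStep hm h) hr
    refine ⟨h.ne, ⟨z, ih _ _ (twoStep_succ_of_reach hm ?_ h1) fun h => h2 (reach_of_twoStep hm h),
      ih _ _ (twoStep_succ_of_reach hm ?_ h3) fun h => h4 (reach_of_twoStep hm h)⟩, hn⟩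
    · rintro rfl; exact hr h3
    · rintro rfl; exact hr h1

theorem twoStep_petersen_of_half_le (hm : 5 ≤ m) {n : ℕ} (hn : m / 2 ≤ 4 * (n + 1))
    (x y : ZMod m ⊕ ZMod m) (hne : x ≠ y) : twoStep (generalizedPetersen m 2) (n + 1) x y := by
  have : NeZero m := ⟨by omega⟩
  have hR := four_mul_le_walkRadius (n + 1)
  refine twoStep_succ_of_reach hm hne ?_
  rcases x with a | a <;> rcases y with b | b <;> have := cycNorm_le_half (b - a) <;>
    simp only [reach]
  · left; omega
  · omega
  · omega
  · left; omega

end Limit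

/-! ### The theorem for `G(m, 2)`. -/

theorem mainTheorem3 (m : ℕ) (hm : 5 ≤ m) :
    HasMetamourLimitPeriod (generalizedPetersen m 2) 2 ∧
    IsMetamourLimitSet (generalizedPetersen m 2)
      {SimpleGraph.fromEdgeSet (FMev (generalizedPetersen m 2)),
       SimpleGraph.fromEdgeSet (FMod (generalizedPetersen m 2))} ∧
    (m ≠ 5 → FMevStabilizesBy (generalizedPetersen m 2) (2 * (m / 2) + m - 8)) ∧
    (m = 5 → FMevStabilizesBy (generalizedPetersen m 2) 2) ∧
    FModStabilizesBy (generalizedPetersen m 2) (2 * (m / 2) + m - 8) ∧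
    (∃ L : ℕ, ∀ l : ℕ, L ≤ l →
      FMev (generalizedPetersen m 2) =
        (metamourIter (generalizedPetersen m 2) (2 * l)).edgeSet ∧
      FMod (generalizedPetersen m 2) =
        (metamourIter (generalizedPetersen m 2) (2 * l + 1)).edgeSet) ∧
    FMev (generalizedPetersen m 2) ∪ FMod (generalizedPetersen m 2) =
      (generalizedPetersen m 2).edgeSet ∪ (generalizedPetersen m 2)ᶜ.edgeSet ∧
    Disjoint (FMev (generalizedPetersen m 2)) (FMod (generalizedPetersen m 2)) := by
  have hE := exists_metamour_of_petersen_adj hm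
  have hT := twoStep_one_of_metamour_petersen hm
  have hD := fullMin_succ_of_twoStep_petersen hm
  have hle : ∀ n, m / 2 ≤ 4 * (n + 1) → ∀ l x y,
      fullMin (generalizedPetersen m 2) l x y → l ≤ n + 1 := fun n hn l x y h =>
    fullMin_index_le hT (twoStep_petersen_of_half_le hm hn) h
  have hfull := twoStep_petersen_of_half_le hm (n := m) (by omega)
  have hne : ∃ x y, (metamour (generalizedPetersen m 2)).Adj x y := by
    refine ⟨.inl 0, .inl ((2 : ℕ) : ZMod m), (metamour_petersen_inl_inl hm).mpr ?_⟩
    rw [sub_zero, cycNorm_natCast (by omega)]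
  refine ⟨hasMetamourLimitPeriod_two hE hT hD hfull hne,
    isMetamourLimitSet_FM hE hT hD hfull hne, fun h5 => ?_, fun h5 => ?_, ?_,
    ⟨m + 1 + 1, fun l hl => ⟨FMev_eq_edgeSet hE hT hD hfull hl,
      FMod_eq_edgeSet hE hT hD hfull hl⟩⟩,
    FMev_union_FMod hD hfull, disjoint_FMev_FMod hT⟩
  · refine FMevStabilizesBy_of_fullMin fun n x y hn h => ?_
    -- The choice `m / 8` satisfies `m / 2 ≤ 4 * (m / 8 + 1)`, so the length `n + 1` is at most `m /
    -- 8 + 2`.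
    have := hle (m / 8) (by omega) n x y h
    omega
  · refine FMevStabilizesBy_of_fullMin fun n x y hn h => ?_
    have := hle 0 (by omega) n x y h
    omega
  · refine FModStabilizesBy_of_fullMin fun n x y hn h => ?_
    -- For `m ≤ 9` all pairs are present at level 1, so an even index is 0. This matters for `m =
    -- 5`, where the bound equals 1.
    by_cases h9 : m ≤ 9
    · have := hle 0 (by omega) n x y h
      omega
    · have := hle (m / 8) (by omega) n x y h
      omega
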